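/- Let $\mathcal X,\mathcal Y$ be real Hilbert spaces, let $f:\mathcal X\to\mathbb R\cup\{+\infty\}$ and $g:\mathcal Y\to\mathbb R\cup\{+\infty\}$ be proper, convex and lower semicontinuous, and let $K:\mathcal X\to\mathcal Y$ be bounded and linear with adjoint $K^*$. Consider the primal problem $$\min_{x\in\mathcal X}\ f(x)+g(Kx). \qquad (P)$$ Let $g^*(y)=\sup_{z\in\mathcal Y}\,\langle z,y\rangle-g(z)$, and for $\tau>0$ let $\operatorname{prox}_{\tau h}(p)$ denote the unique minimizer of $z\mapsto h(z)+\frac1{2\tau}\|z-p\|^2$. Let $(t_k)_{k\in\mathbb N}$ and $(s_k)_{k\in\mathbb N}$ be sequences of positive real numbers with $$t_k\to t>0,\quad \sum_{k}|t_{k+1}-t_k|<\infty,\qquad s_k\to s>0,\quad \sum_{k}|s_{k+1}-s_k|<\infty .$$ For arbitrary starting points $p^0\in\mathcal X$, $q^0\in\mathcal Y$, consider the non-stationary primal–dual Douglas–Rachford iteration $$\begin{cases} x^k=\operatorname{prox}_{t_kf}(p^k),\qquad y^k=\operatorname{prox}_{s_kg^*}(q^k),\\[2pt] \begin{bmatrix}u^k\\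 v^k\end{bmatrix}=\begin{bmatrix}\mathbb I & t_kK^*\\ -s_kK & \mathbb I\end{bmatrix}^{-1}\begin{bmatrix}2x^k-p^k\\ 2y^k-q^k\end{bmatrix},\\[2pt] p^{k+1}=p^k+u^k-x^k,\qquad q^{k+1}=q^k+v^k-y^k . \end{cases}$$ Assume that $(P)$ has a minimizer with finite objective value and that $(P)$ is regular in the sense that its minimizers $z$ (with finite objective value) satisfy the optimality condition $0\in\partial f(z)+K^*\partial g(Kz)$, where $\partial$ denotes the convex subdifferential. Then the iteration converges weakly, that is, each of the sequences $(x^k)$, $(y^k)$, $(u^k)$, $(v^k)$, $(p^k)$, $(q^k)$ converges weakly, and the weak limit of $(x^k)$ is a minimizer of $(P)$ with finite objective value. -/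

import Mathlib

open Filter Topology
open scoped Pointwise

namespace PDDR

/-- Proper, convex and lower semicontinuous functions with values in `ℝ ∪ {+∞}`
(as `EReal`-valued functions that never take the value `-∞`). -/
structure ProperConvexLSC {E : Type*} [NormedAddCommGroup E] [InnerProductSpace ℝ E]
    (h : E → EReal) : Prop where
  ne_bot : ∀ x, h x ≠ ⊥
  exists_ne_top : ∃ x, h x ≠ ⊤
  convex : ∀ x y : E, ∀ a b : ℝ, 0 < a → 0 < b → a + b = 1 →
    h (a • x + b • y) ≤ (a : EReal) * h x + (b : EReal) * h y
  lsc : LowerSemicontinuous h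

/-- The Fenchel conjugate `h*(y) = sup_z ⟨z, y⟩ - h z`. -/
noncomputable def conjugate {E : Type*} [NormedAddCommGroup E] [InnerProductSpace ℝ E]
    (h : E → EReal) (y : E) : EReal :=
  ⨆ z : E, ((inner ℝ z y : ℝ) : EReal) - h z

/-- The convex subdifferential `∂h(x)`. For proper `h` it is empty where `h x = +∞`. -/
def subdifferential {E : Type*} [NormedAddCommGroup E] [InnerProductSpace ℝ E]
    (h : E → EReal) (x : E) : Set E :=
  {v | ∀ z : E, h x + ((inner ℝ v (z - x) : ℝ) : EReal) ≤ h z}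

/-- `IsProx τ h p x` says `x = prox_{τ h}(p)`, that is, `x` minimizes
`z ↦ h z + ‖z - p‖² / (2 τ)`. For `τ > 0` and `h` proper, convex and lower semicontinuous
there is exactly one such `x`. -/
def IsProx {E : Type*} [NormedAddCommGroup E] [InnerProductSpace ℝ E]
    (τ : ℝ) (h : E → EReal) (p x : E) : Prop :=
  ∀ z : E, h x + ((‖x - p‖ ^ 2 / (2 * τ) : ℝ) : EReal)
    ≤ h z + ((‖z - p‖ ^ 2 / (2 * τ) : ℝ) : EReal)

/-- `x` is a minimizer of `φ` with a finite minimal value (`φ` is meant to avoid `-∞`). -/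
def IsFiniteMinimizer {E : Type*} (φ : E → EReal) (x : E) : Prop :=
  φ x ≠ ⊤ ∧ ∀ z : E, φ x ≤ φ z

/-- Weak convergence of a sequence in a real inner product space. -/
def WeaklyTendsto {E : Type*} [NormedAddCommGroup E] [InnerProductSpace ℝ E]
    (x : ℕ → E) (a : E) : Prop :=
  Tendsto (fun k => toWeakSpace ℝ E (x k)) atTop (𝓝 (toWeakSpace ℝ E a))

/-- The objective `f(x) + g(K x)` of the primal problem. -/
noncomputable def primalObjective {X Y : Type*}
    [NormedAddCommGroup X] [InnerProductSpace ℝ X]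
    [NormedAddCommGroup Y] [InnerProductSpace ℝ Y]
    (f : X → EReal) (g : Y → EReal) (K : X →L[ℝ] Y) (x : X) : EReal :=
  f x + g (K x)

/-- The sequences `x, y, u, v, p, q` are generated, from the arbitrary starting point
`(p 0, q 0)`, by the non-stationary primal-dual Douglas-Rachford iteration with primal stepsizes
`t k` and dual stepsizes `s k`. The two `linear` equations say that `(u k, v k)` is the image of
`(2 x k - p k, 2 y k - q k)` under the inverse of the (boundedly invertible) block operator
`[[I, t k K*], [-s k K, I]]`. -/
structure IsPrimalDualDR {X Y : Type*}
    [NormedAddCommGroup X] [InnerProductSpace ℝ X] [CompleteSpace X]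
    [NormedAddCommGroup Y] [InnerProductSpace ℝ Y] [CompleteSpace Y]
    (f : X → EReal) (g : Y → EReal) (K : X →L[ℝ] Y) (t s : ℕ → ℝ)
    (x : ℕ → X) (y : ℕ → Y) (u : ℕ → X) (v : ℕ → Y) (p : ℕ → X) (q : ℕ → Y) : Prop where
  prox_primal : ∀ k, IsProx (t k) f (p k) (x k)
  prox_dual : ∀ k, IsProx (s k) (conjugate g) (q k) (y k)
  linear_primal : ∀ k,
    u k + t k • ContinuousLinearMap.adjoint K (v k) = (2 : ℝ) • x k - p k
  linear_dual : ∀ k, -(s k • K (u k)) + v k = (2 : ℝ) • y k - q k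
  update_primal : ∀ k, p (k + 1) = p k + u k - x k
  update_dual : ∀ k, q (k + 1) = q k + v k - y k

end PDDR

/-! Regularity turns a minimizer into a saddle point `(z, w)`: `-K* w ∈ ∂f(z)` and `K z ∈ ∂g*(w)`.
With stepsizes `t, s` its fixed point is `(z - t K* w, w + s K z)`. In the metric `s‖·‖² + t‖·‖²`
one step brings `(p, q)` closer to that point, with the gain `s‖u - x‖² + t‖v - y‖²`: the prox terms
are monotone and, with exactly these weights, the skew coupling cancels (`norm_sub_add_le_of_step`).

When the stepsizes change, both metric and fixed point move by `O(|Δt| + |Δs|)`, which is summable.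
Hence for every saddle point the distance `lyapunov` converges, and `u - x → 0`, `v - y → 0`
(`IsPrimalDualDR.lyapunov_tendsto`).

Bounded iterates have weak limits along every ultrafilter. These limits are saddle points: in the
sum of the two subgradient inequalities the bilinear terms, which are not weakly continuous, cancel
asymptotically (`IsPrimalDualDR.exists_saddle_limit`). Opial's argument on `(p, q)` shows that all
ultrafilters give the same limit (`saddle_limit_unique`), so the sequences converge weakly. Finally,
the primal part of a saddle point is a minimizer. -/

namespace PDDR

/-! ### Epigraphs, conjugates, prox and affine minorants -/

section ConvexAnalysis

variable {E : Type*} [NormedAddCommGroup E] [InnerProductSpace ℝ E]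

/-- Weak convergence along an arbitrary filter, in terms of inner products. -/
def InnerTendsto {ι : Type*} (x : ι → E) (l : Filter ι) (a : E) : Prop :=
  ∀ w : E, Tendsto (fun i => inner ℝ (x i) w) l (𝓝 (inner ℝ a w))

/-- The pairs `(x, r)` with real `r` that lie above the graph of `h`. -/
def realEpigraph (h : E → EReal) : Set (E × ℝ) := {w | h w.1 ≤ (w.2 : EReal)}

/-- The subgradient inequality for `v` at `x`, where `h x = φ` is a real number. -/
def IsRealSubgradient (h : E → EReal) (x : E) (φ : ℝ) (v : E) : Prop :=
  ∀ z : E, ∀ r : ℝ, h z ≤ (r : EReal) → φ + inner ℝ v (z - x) ≤ r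

theorem exists_real_eq {a : EReal} (hb : a ≠ ⊥) (ht : a ≠ ⊤) : ∃ r : ℝ, a = r :=
  ⟨a.toReal, (EReal.coe_toReal ht hb).symm⟩

theorem mem_subdifferential_iff {h : E → EReal} (hb : ∀ z, h z ≠ ⊥) {x : E} {φ : ℝ}
    (hx : h x = φ) {v : E} : v ∈ subdifferential h x ↔ IsRealSubgradient h x φ v := by
  constructor
  · intro hv z r hr
    have := (hv z).trans hr
    rw [hx] at this
    exact_mod_cast this
  · intro hv z
    by_cases ht : h z = ⊤
    · rw [ht]; exact le_top
    · obtain ⟨r, hr⟩ := exists_real_eq (hb z) ht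
      have := hv z r hr.le
      rw [hx, hr]
      exact_mod_cast this

theorem exists_real_of_mem_subdifferential {h : E → EReal} (hb : ∀ z, h z ≠ ⊥)
    (hne : ∃ z, h z ≠ ⊤) {x v : E} (hv : v ∈ subdifferential h x) :
    ∃ φ : ℝ, h x = φ ∧ IsRealSubgradient h x φ v := by
  have hx : h x ≠ ⊤ := by
    intro hx
    obtain ⟨z, hz⟩ := hne
    have := hv z
    rw [hx, EReal.top_add_coe] at this
    exact hz (top_le_iff.mp this)
  obtain ⟨φ, hφ⟩ := exists_real_eq (hb x) hx
  exact ⟨φ, hφ, (mem_subdifferential_iff hb hφ).mp hv⟩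

theorem ProperConvexLSC.convex_realEpigraph {h : E → EReal} (hh : ProperConvexLSC h) :
    Convex ℝ (realEpigraph h) := by
  rw [convex_iff_forall_pos]
  rintro ⟨x, r⟩ hx ⟨y, r'⟩ hy a b ha hb hab
  simp only [realEpigraph, Set.mem_ofPred_eq, Prod.smul_mk, Prod.mk_add_mk, smul_eq_mul] at *
  refine (hh.convex x y a b ha hb hab).trans ?_
  push_cast
  exact add_le_add (mul_le_mul_of_nonneg_left hx (by exact_mod_cast ha.le))
    (mul_le_mul_of_nonneg_left hy (by exact_mod_cast hb.le))

theorem ProperConvexLSC.isClosed_realEpigraph {h : E → EReal} (hh : ProperConvexLSC h) :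
    IsClosed (realEpigraph h) :=
  hh.lsc.isClosed_epigraph.preimage
    (continuous_fst.prodMk (continuous_coe_real_ereal.comp continuous_snd))

theorem conjugate_le_iff (h : E → EReal) (y : E) (r : ℝ) :
    conjugate h y ≤ r ↔ ∀ z, ((inner ℝ z y - r : ℝ) : EReal) ≤ h z := by
  simp only [conjugate, iSup_le_iff]
  refine forall_congr' fun z => ?_
  induction h z with
  | bot =>
    simp only [EReal.coe_sub_bot, top_le_iff, EReal.coe_ne_top, le_bot_iff, EReal.coe_ne_bot]
  | top => simp
  | coe a => norm_cast; constructor <;> intro _ <;> linarith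

theorem inner_le_of_conjugate_le {h : E → EReal} {y z : E} {r a : ℝ}
    (hy : conjugate h y ≤ r) (hz : h z ≤ a) : inner ℝ z y ≤ a + r := by
  have := ((conjugate_le_iff h y r).mp hy z).trans hz
  have : inner ℝ z y - r ≤ a := by exact_mod_cast this
  linarith

theorem ProperConvexLSC.conjugate_ne_bot {h : E → EReal} (hh : ProperConvexLSC h) (y : E) :
    conjugate h y ≠ ⊥ := by
  intro hy
  obtain ⟨z, hz⟩ := hh.exists_ne_top
  obtain ⟨a, ha⟩ := exists_real_eq (hh.ne_bot z) hz
  -- Every real bounds `⊥`; this `r` makes Fenchel–Young read `⟨z, y⟩ ≤ ⟨z, y⟩ - 1`.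
  have := inner_le_of_conjugate_le (r := inner ℝ z y - a - 1) (hy.trans_le bot_le) ha.le
  linarith

/-- A supremum of affine functions is convex, whatever `h` is. The prox characterization needs only
this, a finite value and the absence of `⊥`. -/
theorem convex_realEpigraph_conjugate (h : E → EReal) :
    Convex ℝ (realEpigraph (conjugate h)) := by
  rw [convex_iff_forall_pos]
  rintro ⟨x, r⟩ hx ⟨y, r'⟩ hy a b ha hb hab
  simp only [realEpigraph, Set.mem_ofPred_eq, Prod.smul_mk, Prod.mk_add_mk, smul_eq_mul] at *
  rw [conjugate_le_iff] at *
  intro z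
  have hx := hx z
  have hy := hy z
  generalize h z = c at *
  rw [inner_add_right, inner_smul_right, inner_smul_right]
  induction c with
  | bot => exact absurd (le_bot_iff.mp hx) (EReal.coe_ne_bot _)
  | top => exact le_top
  | coe c =>
    norm_cast at *
    calc a * inner ℝ z x + b * inner ℝ z y - (a * r + b * r')
        = a * (inner ℝ z x - r) + b * (inner ℝ z y - r') := by ring
      _ ≤ a * c + b * c := by gcongr
      _ = c := by rw [← add_mul, hab, one_mul]

/-- If `x = prox_{τ h}(p)`, then `(p - x) / τ` is a subgradient of `h` at `x`. -/
theorem IsProx.exists_isRealSubgradient {h : E → EReal} (hb : ∀ z, h z ≠ ⊥)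
    (hne : ∃ z, h z ≠ ⊤) (hc : Convex ℝ (realEpigraph h)) {τ : ℝ} (hτ : 0 < τ) {p x : E}
    (hx : IsProx τ h p x) :
    ∃ φ : ℝ, h x = φ ∧ IsRealSubgradient h x φ (τ⁻¹ • (p - x)) := by
  have hxt : h x ≠ ⊤ := by
    intro hx'
    obtain ⟨z, hz⟩ := hne
    obtain ⟨a, ha⟩ := exists_real_eq (hb z) hz
    have := hx z
    rw [hx', EReal.top_add_coe, ha, ← EReal.coe_add] at this
    exact EReal.coe_ne_top _ (top_le_iff.mp this)
  obtain ⟨φ, hφ⟩ := exists_real_eq (hb x) hxt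
  refine ⟨φ, hφ, fun z r hr => ?_⟩
  -- Compare `x` with `(1 - l) • x + l • z` and divide by `l`; the quadratic remainder vanishes as
  -- `l → 0`.
  have key : ∀ l : ℝ, 0 < l → l < 1 →
      φ - r ≤ inner ℝ (x - p) (z - x) / τ + l * (‖z - x‖ ^ 2 / (2 * τ)) := by
    intro l hl hl1
    have h1 : ((x, φ) : E × ℝ) ∈ realEpigraph h := hφ.le
    have h2 : ((z, r) : E × ℝ) ∈ realEpigraph h := hr
    have h3 := hc h1 h2 (by linarith : 0 ≤ 1 - l) hl.le (by ring)
    simp only [realEpigraph, Set.mem_ofPred_eq, Prod.smul_mk, Prod.mk_add_mk, smul_eq_mul] at h3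
    have h4 := (hx ((1 - l) • x + l • z)).trans (add_le_add_left h3 _)
    rw [hφ] at h4
    norm_cast at h4
    have h5 : (1 - l) • x + l • z - p = (x - p) + l • (z - x) := by module
    rw [h5, norm_add_sq_real, norm_smul, inner_smul_right, mul_pow, Real.norm_eq_abs,
      sq_abs] at h4
    have h6 : l * (φ - r) ≤
        l * (inner ℝ (x - p) (z - x) / τ + l * (‖z - x‖ ^ 2 / (2 * τ))) := by
      have : (‖x - p‖ ^ 2 + 2 * (l * inner ℝ (x - p) (z - x)) + l ^ 2 * ‖z - x‖ ^ 2) / (2 * τ)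
        = ‖x - p‖ ^ 2 / (2 * τ) + l * (inner ℝ (x - p) (z - x) / τ)
          + l * (l * (‖z - x‖ ^ 2 / (2 * τ))) := by field_simp
      rw [this] at h4
      linarith
    exact le_of_mul_le_mul_left h6 hl
  have hlim : Tendsto (fun l : ℝ => inner ℝ (x - p) (z - x) / τ + l * (‖z - x‖ ^ 2 / (2 * τ)))
      (𝓝[>] 0) (𝓝 (inner ℝ (x - p) (z - x) / τ)) := by
    have : Continuous fun l : ℝ =>
      inner ℝ (x - p) (z - x) / τ + l * (‖z - x‖ ^ 2 / (2 * τ)) := by fun_prop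
    have := this.tendsto 0
    rw [zero_mul, add_zero] at this
    exact this.mono_left nhdsWithin_le_nhds
  have hle : φ - r ≤ inner ℝ (x - p) (z - x) / τ := by
    refine ge_of_tendsto hlim ?_
    filter_upwards [Ioo_mem_nhdsGT (zero_lt_one : (0 : ℝ) < 1)] with l hl
    exact key l hl.1 hl.2
  have : inner ℝ (τ⁻¹ • (p - x)) (z - x) = -(inner ℝ (x - p) (z - x) / τ) := by
    rw [real_inner_smul_left, ← neg_sub x p, inner_neg_left]; ring
  rw [this]; linarith

theorem IsRealSubgradient.monotone {h : E → EReal} {x x' v v' : E} {φ φ' : ℝ}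
    (hx : h x = φ) (hx' : h x' = φ') (hv : IsRealSubgradient h x φ v)
    (hv' : IsRealSubgradient h x' φ' v') : 0 ≤ inner ℝ (v - v') (x - x') := by
  have h1 := hv x' φ' hx'.le
  have h2 := hv' x φ hx.le
  rw [← neg_sub x x', inner_neg_right] at h1
  rw [inner_sub_left]
  linarith

/-- For each fixed `z` the bound `⟨z, y⟩ - φ ≤ h z` passes to weak limits, so no convexity of `h` is
needed. -/
theorem conjugate_le_of_weak_tendsto (h : E → EReal)
    {ι : Type*} {l : Filter ι} [l.NeBot] {y : ι → E} {φ : ι → ℝ} {a : E} {c : ℝ}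
    (hy : InnerTendsto y l a)
    (hφ : Tendsto φ l (𝓝 c)) (hle : ∀ i, conjugate h (y i) ≤ φ i) : conjugate h a ≤ c := by
  rw [conjugate_le_iff]
  intro z
  have h1 := fun i => (conjugate_le_iff h _ _).mp (hle i) z
  generalize h z = b at *
  have ht : Tendsto (fun i => inner ℝ z (y i) - φ i) l (𝓝 (inner ℝ z a - c)) := by
    simpa only [real_inner_comm] using (hy z).sub hφ
  induction b with
  | bot =>
    obtain ⟨i⟩ := l.nonempty_of_neBot
    exact absurd (le_bot_iff.mp (h1 i)) (EReal.coe_ne_bot _)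
  | top => exact le_top
  | coe b =>
    norm_cast at *
    exact le_of_tendsto ht (Eventually.of_forall h1)

variable [CompleteSpace E]

/-- The product norm on `E × ℝ` is not Hilbertian, so Riesz is applied to the restriction to `E`. -/
theorem exists_inner_add_mul (L : StrongDual ℝ (E × ℝ)) :
    ∃ (η : E) (β : ℝ), ∀ w : E × ℝ, L w = inner ℝ w.1 η + β * w.2 := by
  refine ⟨(InnerProductSpace.toDual ℝ E).symm (L.comp (ContinuousLinearMap.inl ℝ E ℝ)),
    L (0, 1), fun w => ?_⟩
  rw [real_inner_comm, InnerProductSpace.toDual_symm_apply]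
  have : w = (w.1, 0) + w.2 • ((0, 1) : E × ℝ) := by ext <;> simp
  conv_lhs => rw [this, map_add, map_smul]
  simp [mul_comm]

/-- Separation of a point from the epigraph of a proper convex lower semicontinuous function. -/
theorem ProperConvexLSC.exists_separation {h : E → EReal} (hh : ProperConvexLSC h) {x : E}
    {c : ℝ} (hc : (c : EReal) < h x) :
    ∃ (η : E) (β μ : ℝ), inner ℝ x η + β * c < μ ∧
      ∀ z : E, ∀ r : ℝ, h z ≤ r → μ < inner ℝ z η + β * r := by
  have hn : ((x, c) : E × ℝ) ∉ realEpigraph h := not_le.mpr hc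
  obtain ⟨L, μ, h1, h2⟩ := geometric_hahn_banach_point_closed hh.convex_realEpigraph
    hh.isClosed_realEpigraph hn
  obtain ⟨η, β, hL⟩ := exists_inner_add_mul L
  refine ⟨η, β, μ, by simpa [hL] using h1, fun z r hr => ?_⟩
  have := h2 (z, r) hr
  rwa [hL] at this

/-- Weak lower semicontinuity, along an arbitrary filter. -/
theorem ProperConvexLSC.le_of_weak_tendsto {h : E → EReal} (hh : ProperConvexLSC h)
    {ι : Type*} {l : Filter ι} [l.NeBot] {x : ι → E} {φ : ι → ℝ} {a : E} {c : ℝ}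
    (hx : InnerTendsto x l a)
    (hφ : Tendsto φ l (𝓝 c)) (hle : ∀ i, h (x i) ≤ φ i) : h a ≤ c := by
  by_contra hlt
  obtain ⟨η, β, μ, h1, h2⟩ := hh.exists_separation (not_le.mp hlt)
  have : μ ≤ inner ℝ a η + β * c :=
    ge_of_tendsto ((hx η).add (hφ.const_mul β))
      (Eventually.of_forall fun i => (h2 _ _ (hle i)).le)
  linarith

/-- A proper convex lower semicontinuous function is the supremum of its affine minorants. -/
theorem ProperConvexLSC.exists_conjugate_le {h : E → EReal} (hh : ProperConvexLSC h) {b : E}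
    {ρ : ℝ} (hb : conjugate h b ≤ ρ) {x : E} {c : ℝ} (hc : (c : EReal) < h x) :
    ∃ (y : E) (r : ℝ), conjugate h y ≤ r ∧ c < inner ℝ x y - r := by
  obtain ⟨η, β, μ, h1, h2⟩ := hh.exists_separation hc
  obtain ⟨z₀, hz₀⟩ := hh.exists_ne_top
  obtain ⟨r₀, hr₀⟩ := exists_real_eq (hh.ne_bot z₀) hz₀
  -- The epigraph is unbounded upwards, so a negative slope would break the separation for large
  -- `r`.
  have hβ : 0 ≤ β := by
    by_contra hβ
    push Not at hβ
    have := h2 z₀ (max r₀ ((μ - inner ℝ z₀ η) / β))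
      (hr₀.le.trans (by exact_mod_cast le_max_left _ _))
    have h3 : β * max r₀ ((μ - inner ℝ z₀ η) / β) ≤ β * ((μ - inner ℝ z₀ η) / β) :=
      mul_le_mul_of_nonpos_left (le_max_right _ _) hβ.le
    rw [mul_div_cancel₀ _ hβ.ne] at h3
    linarith
  have of_forall : ∀ (y : E) (r : ℝ), (∀ z a, h z = ((a : ℝ) : EReal) → inner ℝ z y - r ≤ a) →
      conjugate h y ≤ r := by
    intro y r hyr
    rw [conjugate_le_iff]
    intro z
    by_cases hz : h z = ⊤
    · rw [hz]; exact le_top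
    · obtain ⟨a, ha⟩ := exists_real_eq (hh.ne_bot z) hz
      rw [ha]
      exact_mod_cast hyr z a ha
  -- A vertical hyperplane (`β = 0`) gives no minorant by itself. Subtracting `l * (⟨·, η⟩ - μ)`,
  -- positive on the domain of `h`, from the given minorant `⟨·, b⟩ - ρ` keeps it a minorant and
  -- raises it by `l * d` at `x`; `l` is chosen to exceed `c`. For `β > 0`, dividing by `β`
  -- suffices.
  rcases hβ.eq_or_lt with rfl | hβ
  · simp only [zero_mul, add_zero] at h1 h2
    set d := μ - inner ℝ x η with hd
    have hdpos : 0 < d := by linarith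
    set l := (|c - (inner ℝ x b - ρ)| + 1) / d with hl
    have hlpos : 0 < l := by positivity
    have hld : l * d = |c - (inner ℝ x b - ρ)| + 1 := div_mul_cancel₀ _ hdpos.ne'
    refine ⟨b - l • η, ρ - l * μ, of_forall _ _ fun z a ha => ?_, ?_⟩
    · have h3 := inner_le_of_conjugate_le hb ha.le
      have h4 := mul_lt_mul_of_pos_left (h2 z a ha.le) hlpos
      rw [inner_sub_right, inner_smul_right]
      linarith
    · rw [inner_sub_right, inner_smul_right]
      have := le_abs_self (c - (inner ℝ x b - ρ))
      rw [hd, mul_sub] at hld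
      linarith
  · refine ⟨-(β⁻¹ • η), -(β⁻¹ * μ), of_forall _ _ fun z a ha => ?_, ?_⟩
    · have h3 := mul_lt_mul_of_pos_left (h2 z a ha.le) (inv_pos.mpr hβ)
      rw [mul_add, inv_mul_cancel_left₀ hβ.ne'] at h3
      rw [inner_neg_right, inner_smul_right]
      linarith
    · have h3 := mul_lt_mul_of_pos_left h1 (inv_pos.mpr hβ)
      rw [mul_add, inv_mul_cancel_left₀ hβ.ne'] at h3
      rw [inner_neg_right, inner_smul_right]
      linarith

end ConvexAnalysis

/-! ### Weak limits along ultrafilters -/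

section WeakConvergence

variable {E : Type*} [NormedAddCommGroup E] [InnerProductSpace ℝ E] [CompleteSpace E]

theorem InnerTendsto.weaklyTendsto {x : ℕ → E} {a : E}
    (h : InnerTendsto x atTop a) :
    WeaklyTendsto x a := by
  unfold WeaklyTendsto
  refine (WeakBilin.tendsto_iff_forall_eval_tendsto (topDualPairing ℝ E).flip ?_).mpr ?_
  · intro a b hab
    have : ∀ L : StrongDual ℝ E, L a = L b := fun L => LinearMap.congr_fun hab L
    exact (SeparatingDual.eq_iff_forall_dual_eq (R := ℝ)).mpr this
  · intro L
    have h1 := h ((InnerProductSpace.toDual ℝ E).symm L)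
    have h2 : ∀ z : E, inner ℝ z ((InnerProductSpace.toDual ℝ E).symm L) = L z := fun z => by
      rw [real_inner_comm, InnerProductSpace.toDual_symm_apply]
    simp only [h2] at h1
    exact h1

theorem exists_tendsto_of_bounded {ι : Type*} (U : Ultrafilter ι) {a : ι → ℝ} {B : ℝ}
    (ha : ∀ i, |a i| ≤ B) : ∃ c, Tendsto a U (𝓝 c) := by
  obtain ⟨c, -, hc⟩ := (isCompact_Icc (a := -B) (b := B)).ultrafilter_le_nhds (U.map a)
    (by
      rw [le_principal_iff]
      exact Filter.mem_map.mpr (Filter.univ_mem' fun i => abs_le.mp (ha i)))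
  exact ⟨c, hc⟩

/-- Bounded families in a Hilbert space have weak limits along ultrafilters. -/
theorem exists_weak_limit {ι : Type*} (U : Ultrafilter ι) {x : ι → E} {B : ℝ}
    (hx : ∀ i, ‖x i‖ ≤ B) :
    ∃ a : E, InnerTendsto x U a := by
  have h1 : ∀ w : E, ∃ c, Tendsto (fun i => inner ℝ (x i) w) U (𝓝 c) := fun w =>
    exists_tendsto_of_bounded U (B := B * ‖w‖) fun i =>
      (abs_real_inner_le_norm _ _).trans (by gcongr; exact hx i)
  -- The pointwise limits form a bounded linear functional; its Riesz representative is the weak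
  -- limit.
  choose L hL using h1
  have hB : ∀ w, ‖L w‖ ≤ B * ‖w‖ := fun w =>
    le_of_tendsto (hL w).norm (Eventually.of_forall fun i =>
      (abs_real_inner_le_norm _ _).trans (by gcongr; exact hx i))
  let F : E →ₗ[ℝ] ℝ :=
    { toFun := L
      map_add' := fun w w' => by
        refine tendsto_nhds_unique (hL (w + w')) ?_
        simpa only [inner_add_right] using (hL w).add (hL w')
      map_smul' := fun c w => by
        refine tendsto_nhds_unique (hL (c • w)) ?_
        rw [RingHom.id_apply, smul_eq_mul]
        simpa only [inner_smul_right] using (hL w).const_mul c }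
  refine ⟨(InnerProductSpace.toDual ℝ E).symm (F.mkContinuous B hB), fun w => ?_⟩
  rw [InnerProductSpace.toDual_symm_apply]
  exact hL w

end WeakConvergence

/-! ### Quasi-Fejér sequences and changes of metric -/

section QuasiFejer

/-- A perturbed descent inequality with summable perturbations gives convergence. -/
theorem tendsto_of_perturbed_descent {a r α : ℕ → ℝ} (ha : ∀ k, 0 ≤ a k) (hr : ∀ k, 0 ≤ r k)
    (hα : ∀ k, 0 ≤ α k) (hsum : Summable α)
    (h : ∀ k, a (k + 1) + r k ≤ (1 + α k) * a k + α k) :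
    (∃ c, Tendsto a atTop (𝓝 c)) ∧ Tendsto r atTop (𝓝 0) := by
  -- Discrete Gronwall: `(1 + α) * a + α + 1 = (1 + α) * (a + 1)`, so passing to `a + 1` absorbs the
  -- additive error.
  have hprod : ∀ k, a k + 1 ≤ (a 0 + 1) * Real.exp (∑ j ∈ Finset.range k, α j) := by
    intro k
    induction k with
    | zero => simp
    | succ k ih =>
      rw [Finset.sum_range_succ, Real.exp_add, ← mul_assoc]
      calc a (k + 1) + 1 ≤ (1 + α k) * (a k + 1) := by linarith [h k, hr k]
        _ = (a k + 1) * (α k + 1) := by ring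
        _ ≤ (a 0 + 1) * Real.exp (∑ j ∈ Finset.range k, α j) * Real.exp (α k) := by
          have := hα k
          exact mul_le_mul ih (Real.add_one_le_exp _) (by linarith)
            ((by linarith [ha k] : (0:ℝ) ≤ a k + 1).trans ih)
  set B := (a 0 + 1) * Real.exp (∑' j, α j)
  have hB : ∀ k, a k + 1 ≤ B := fun k => (hprod k).trans <| by
    have := ha 0
    have := hsum.sum_le_tsum (Finset.range k) (fun j _ => hα j)
    simp only [B]
    gcongr
  have hB0 : 0 ≤ B := by linarith [hB 0, ha 0]
  -- The error `α k * (a k + 1)` is at most `B * α k`; subtracting the accumulated errors leaves a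
  -- nonincreasing sequence, bounded below.
  set c : ℕ → ℝ := fun k => a k - B * ∑ j ∈ Finset.range k, α j
  have hstep : ∀ k, c (k + 1) + r k ≤ c k := by
    intro k
    simp only [c, Finset.sum_range_succ]
    have := mul_le_mul_of_nonneg_left (hB k) (hα k)
    linarith [h k]
  have hanti : Antitone c := antitone_nat_of_succ_le fun k => by linarith [hstep k, hr k]
  have hbdd : BddBelow (Set.range c) := by
    refine ⟨-(B * ∑' j, α j), ?_⟩
    rintro _ ⟨k, rfl⟩
    have := mul_le_mul_of_nonneg_left (hsum.sum_le_tsum (Finset.range k) (fun j _ => hα j)) hB0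
    simp only [c]
    linarith [ha k]
  have hc := tendsto_atTop_ciInf hanti hbdd
  constructor
  · refine ⟨_, (hc.add (hsum.hasSum.tendsto_sum_nat.const_mul B)).congr fun k => ?_⟩
    simp only [c]; ring
  · refine squeeze_zero hr (fun k => (by linarith [hstep k] : r k ≤ c k - c (k + 1))) ?_
    simpa using hc.sub (hc.comp (tendsto_add_atTop_nat 1))

variable {E : Type*} [NormedAddCommGroup E] [InnerProductSpace ℝ E]

/-- Effect on a weighted squared norm of a change of the weight and a shift of the argument. -/
theorem weight_mul_norm_add_sq_le {m M w w' δ D : ℝ} (hm : 0 < m) (hw : m ≤ w) (hw' : 0 ≤ w')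
    (hM : w' ≤ M) (hD : |w' - w| ≤ D) (hδ : |δ| ≤ D) (hDM : D ≤ M) (a c : E) :
    w' * ‖a + δ • c‖ ^ 2 ≤
      (1 + (1 + M) / m * D) * (w * ‖a‖ ^ 2) + M * (1 + M) * ‖c‖ ^ 2 * D := by
  have hD0 : 0 ≤ D := (abs_nonneg _).trans hD
  have hM0 : 0 ≤ M := hD0.trans hDM
  have h1 : ‖a + δ • c‖ ^ 2 ≤ (1 + D) * ‖a‖ ^ 2 + D * (1 + M) * ‖c‖ ^ 2 := by
    have h2 : ‖a + δ • c‖ ≤ ‖a‖ + D * ‖c‖ := by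
      refine (norm_add_le _ _).trans ?_
      rw [norm_smul, Real.norm_eq_abs]
      gcongr
    calc ‖a + δ • c‖ ^ 2 ≤ (‖a‖ + D * ‖c‖) ^ 2 := by gcongr
      _ = ‖a‖ ^ 2 + D * (2 * ‖a‖ * ‖c‖) + D * D * ‖c‖ ^ 2 := by ring
      _ ≤ ‖a‖ ^ 2 + D * (‖a‖ ^ 2 + ‖c‖ ^ 2) + D * M * ‖c‖ ^ 2 := by
        gcongr
        exact two_mul_le_add_sq _ _
      _ = _ := by ring
  -- The lower bound `m ≤ w` makes the additive error `(1 + M) * D` proportional to `w`.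
  have h3 : w' * (1 + D) ≤ (1 + (1 + M) / m * D) * w := by
    have h4 : w' ≤ w + D := by linarith [le_abs_self (w' - w)]
    have h5 : (1 + M) * D ≤ (1 + M) / m * D * w := by
      calc (1 + M) * D = (1 + M) / m * D * m := by field_simp
        _ ≤ _ := by gcongr
    nlinarith [mul_le_mul_of_nonneg_right hM hD0]
  calc w' * ‖a + δ • c‖ ^ 2 ≤ w' * ((1 + D) * ‖a‖ ^ 2 + D * (1 + M) * ‖c‖ ^ 2) := by gcongr
    _ = w' * (1 + D) * ‖a‖ ^ 2 + w' * (D * (1 + M) * ‖c‖ ^ 2) := by ring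
    _ ≤ (1 + (1 + M) / m * D) * w * ‖a‖ ^ 2 + M * (D * (1 + M) * ‖c‖ ^ 2) := by gcongr
    _ = _ := by ring

end QuasiFejer

/-! ### Saddle points and the one-step estimate -/

section PrimalDual

variable {X Y : Type*}
  [NormedAddCommGroup X] [InnerProductSpace ℝ X] [CompleteSpace X]
  [NormedAddCommGroup Y] [InnerProductSpace ℝ Y] [CompleteSpace Y]

/-- The primal-dual optimality system `-K* y ∈ ∂f(x)`, `K x ∈ ∂g*(y)`. -/
def IsSaddle (f : X → EReal) (g : Y → EReal) (K : X →L[ℝ] Y) (x : X) (y : Y) : Prop :=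
  ∃ φ γ : ℝ, f x = φ ∧ conjugate g y = γ ∧
    IsRealSubgradient f x φ (-(ContinuousLinearMap.adjoint K y)) ∧
    IsRealSubgradient (conjugate g) y γ (K x)

variable {f : X → EReal} {g : Y → EReal} {K : X →L[ℝ] Y}

/-- Since `g` is the supremum of its affine minorants, `K x ∈ ∂g*(y)` gives `g (K x) ≤ ⟨K x, y⟩ -
γ`. For a competitor `z`, add the subgradient inequality of `f` to Fenchel–Young for `g (K z)`; the
terms `⟨K z, y⟩` cancel. -/
theorem IsSaddle.isFiniteMinimizer (hf : ProperConvexLSC f) (hg : ProperConvexLSC g)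
    {x : X} {y : Y} (h : IsSaddle f g K x y) :
    IsFiniteMinimizer (primalObjective f g K) x := by
  obtain ⟨φ, γ, hφ, hγ, h1, h2⟩ := h
  have hgK : g (K x) ≤ ((inner ℝ (K x) y - γ : ℝ) : EReal) := by
    by_contra hlt
    obtain ⟨y', r, hr, hlt'⟩ := hg.exists_conjugate_le hγ.le (not_le.mp hlt)
    have := h2 y' r hr
    rw [inner_sub_right] at this
    linarith
  have hle : primalObjective f g K x ≤ ((φ + (inner ℝ (K x) y - γ) : ℝ) : EReal) := by
    rw [EReal.coe_add, primalObjective, hφ]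
    gcongr
  refine ⟨fun ht => ?_, fun z => hle.trans ?_⟩
  · rw [ht] at hle
    exact EReal.coe_ne_top _ (top_le_iff.mp hle)
  · by_cases hz : f z = ⊤
    · rw [primalObjective, hz, EReal.top_add_of_ne_bot (hg.ne_bot _)]
      exact le_top
    by_cases hz' : g (K z) = ⊤
    · rw [primalObjective, hz', EReal.add_top_of_ne_bot (hf.ne_bot _)]
      exact le_top
    obtain ⟨a, ha⟩ := exists_real_eq (hf.ne_bot z) hz
    obtain ⟨b, hb⟩ := exists_real_eq (hg.ne_bot _) hz'
    have h3 := h1 z a ha.le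
    have h4 := inner_le_of_conjugate_le hγ.le hb.le
    rw [inner_neg_left, ContinuousLinearMap.adjoint_inner_left, map_sub, inner_sub_right,
      real_inner_comm, real_inner_comm (K x)] at h3
    rw [primalObjective, ha, hb, ← EReal.coe_add]
    exact_mod_cast by linarith

/-- Equality in Fenchel–Young, `g (K z) + g*(y) = ⟨K z, y⟩`, converts `y ∈ ∂g(K z)` into `K z ∈
∂g*(y)`. -/
theorem exists_isSaddle (hf : ProperConvexLSC f) (hg : ProperConvexLSC g) {z : X}
    (hz : (0 : X) ∈ subdifferential f z +
      ContinuousLinearMap.adjoint K '' subdifferential g (K z)) :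
    ∃ y, IsSaddle f g K z y := by
  obtain ⟨a, ha, _, ⟨y, hy, rfl⟩, h0⟩ := hz
  simp only at h0
  obtain ⟨φ, hφ, h1⟩ := exists_real_of_mem_subdifferential hf.ne_bot hf.exists_ne_top ha
  obtain ⟨ψ, hψ, h2⟩ := exists_real_of_mem_subdifferential hg.ne_bot hg.exists_ne_top hy
  have hle : conjugate g y ≤ ((inner ℝ (K z) y - ψ : ℝ) : EReal) := by
    rw [conjugate_le_iff]
    intro w
    have := hy w
    rw [hψ, ← EReal.coe_add] at this
    convert this using 2
    rw [inner_sub_right, real_inner_comm y, real_inner_comm (K z)]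
    ring
  have hγ : conjugate g y = ((inner ℝ (K z) y - ψ : ℝ) : EReal) := by
    refine le_antisymm hle ?_
    obtain ⟨γ, hγ⟩ := exists_real_eq (hg.conjugate_ne_bot y)
      (ne_top_of_le_ne_top (EReal.coe_ne_top _) hle)
    have := inner_le_of_conjugate_le hγ.le hψ.le
    rw [hγ]
    exact_mod_cast by linarith
  refine ⟨y, φ, _, hφ, hγ, ?_, fun y' r hr => ?_⟩
  · rwa [← eq_neg_of_add_eq_zero_left h0]
  · have := inner_le_of_conjugate_le hr hψ.le
    rw [inner_sub_right]
    linarith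

theorem IsSaddle.conjugate_proper {x : X} {y : Y} (h : IsSaddle f g K x y) :
    ∃ z, conjugate g z ≠ ⊤ := by
  obtain ⟨φ, γ, -, hγ, -⟩ := h
  exact ⟨y, hγ ▸ EReal.coe_ne_top _⟩

theorem norm_le_norm_add_of_inner_nonneg {E : Type*} [NormedAddCommGroup E]
    [InnerProductSpace ℝ E] {m a : E} (h : 0 ≤ inner ℝ m a) : ‖a‖ ≤ ‖m + a‖ := by
  refine le_of_sq_le_sq ?_ (norm_nonneg _)
  rw [norm_add_sq_real]
  linarith [sq_nonneg ‖m‖]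

/-- One step of the iteration decreases the weighted distance to the fixed point that belongs to
a saddle point. -/
theorem norm_sub_add_le_of_step (hf : ProperConvexLSC f) (hg : ProperConvexLSC g)
    {z : X} {w : Y} (h : IsSaddle f g K z w) {t s : ℝ} (ht : 0 < t) (hs : 0 < s)
    {x u p : X} {y v q : Y} (hx : IsProx t f p x) (hy : IsProx s (conjugate g) q y)
    (hu : u + t • ContinuousLinearMap.adjoint K v = (2 : ℝ) • x - p)
    (hv : -(s • K u) + v = (2 : ℝ) • y - q) :
    s * ‖p + u - x - (z - t • ContinuousLinearMap.adjoint K w)‖ ^ 2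
        + t * ‖q + v - y - (w + s • K z)‖ ^ 2 + (s * ‖u - x‖ ^ 2 + t * ‖v - y‖ ^ 2)
      ≤ s * ‖p - (z - t • ContinuousLinearMap.adjoint K w)‖ ^ 2
        + t * ‖q - (w + s • K z)‖ ^ 2 ∧
    ‖x - z‖ ≤ ‖p - (z - t • ContinuousLinearMap.adjoint K w)‖ ∧
    ‖y - w‖ ≤ ‖q - (w + s • K z)‖ := by
  have hne := h.conjugate_proper
  obtain ⟨φ, γ, hφ, hγ, h1, h2⟩ := h
  obtain ⟨φ', hφ', h1'⟩ := hx.exists_isRealSubgradient hf.ne_bot hf.exists_ne_top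
    hf.convex_realEpigraph ht
  obtain ⟨γ', hγ', h2'⟩ := hy.exists_isRealSubgradient hg.conjugate_ne_bot hne
    (convex_realEpigraph_conjugate g) hs
  set A := ContinuousLinearMap.adjoint K with hA
  -- Coordinates centred at the saddle point; the linear system then determines `p` and `q`.
  obtain ⟨a, rfl⟩ : ∃ a, x = z + a := ⟨x - z, by abel⟩
  obtain ⟨b, rfl⟩ : ∃ b, y = w + b := ⟨y - w, by abel⟩
  obtain ⟨c, rfl⟩ : ∃ c, u = z + c := ⟨u - z, by abel⟩
  obtain ⟨d, rfl⟩ : ∃ d, v = w + d := ⟨v - w, by abel⟩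
  have hp : p = z - t • A w + ((2 : ℝ) • a - c - t • A d) := by
    rw [eq_sub_iff_add_eq] at hu
    rw [← sub_eq_of_eq_add' hu.symm, map_add]
    module
  have hq : q = w + s • K z + ((2 : ℝ) • b - d + s • K c) := by
    rw [eq_sub_iff_add_eq] at hv
    rw [← sub_eq_of_eq_add' hv.symm, map_add]
    module
  have m1 := h1'.monotone hφ' hφ h1
  have m2 := h2'.monotone hγ' hγ h2
  have e1 : t⁻¹ • (p - (z + a)) - -A w = t⁻¹ • (a - c - t • A d) := by
    rw [hp, sub_neg_eq_add, ← inv_smul_smul₀ ht.ne' (A w), ← smul_add,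
      smul_inv_smul₀ ht.ne']
    congr 1
    module
  have e2 : s⁻¹ • (q - (w + b)) - K z = s⁻¹ • (b - d + s • K c) := by
    rw [hq, ← inv_smul_smul₀ hs.ne' (K z), ← smul_sub, smul_inv_smul₀ hs.ne']
    congr 1
    module
  rw [e1, add_sub_cancel_left, real_inner_smul_left] at m1
  rw [e2, add_sub_cancel_left, real_inner_smul_left] at m2
  replace m1 := (mul_nonneg_iff_of_pos_left (inv_pos.mpr ht)).mp m1
  replace m2 := (mul_nonneg_iff_of_pos_left (inv_pos.mpr hs)).mp m2
  have hskew : inner ℝ (A d) c = inner ℝ (K c) d := by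
    rw [hA, ContinuousLinearMap.adjoint_inner_left, real_inner_comm]
  have i1 : p - (z - t • A w) = (a - c - t • A d) + a := by rw [hp]; module
  have i2 : q - (w + s • K z) = (b - d + s • K c) + b := by rw [hq]; module
  have i3 : p + (z + c) - (z + a) - (z - t • A w) = a - t • A d := by rw [hp]; module
  have i4 : q + (w + d) - (w + b) - (w + s • K z) = b + s • K c := by rw [hq]; module
  rw [i1, i2, i3, i4, add_sub_cancel_left, add_sub_cancel_left, add_sub_add_left_eq_sub,
    add_sub_add_left_eq_sub]
  refine ⟨?_, norm_le_norm_add_of_inner_nonneg m1, norm_le_norm_add_of_inner_nonneg m2⟩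
  -- In the expanded squares the cross terms are the monotonicity products `m1`, `m2` and the
  -- coupling terms, which the weights `s` and `t` turn into `± 2 s t ⟨K c, d⟩`.
  have j1 : a - c - t • A d + a = (a - t • A d) - (c - a) := by module
  have j2 : b - d + s • K c + b = (b + s • K c) - (d - b) := by module
  rw [j1, j2, norm_sub_sq_real (a - t • A d), norm_sub_sq_real (b + s • K c)]
  have k1 : inner ℝ (a - t • A d) (c - a) =
      -inner ℝ (a - c - t • A d) a - t * inner ℝ (A d) c := by
    simp only [inner_sub_left, inner_sub_right, real_inner_smul_left, real_inner_comm a c]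
    ring
  have k2 : inner ℝ (b + s • K c) (d - b) =
      -inner ℝ (b - d + s • K c) b + s * inner ℝ (K c) d := by
    simp only [inner_sub_left, inner_sub_right, inner_add_left, real_inner_smul_left,
      real_inner_comm b d]
    ring
  rw [k1, k2, hskew]
  have := mul_nonneg hs.le m1
  have := mul_nonneg ht.le m2
  linarith

end PrimalDual

/-! ### Convergence of the non-stationary iteration -/

section Iteration

theorem exists_pos_bounds {t : ℕ → ℝ} {c : ℝ} (ht : ∀ k, 0 < t k) (hc : 0 < c)
    (h : Tendsto t atTop (𝓝 c)) : ∃ m M, 0 < m ∧ ∀ k, m ≤ t k ∧ t k ≤ M := by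
  obtain ⟨M, hM⟩ := h.bddAbove_range
  obtain ⟨B, hB⟩ := (h.inv₀ hc.ne').bddAbove_range
  have hB' : ∀ k, (t k)⁻¹ ≤ B := fun k => hB ⟨k, rfl⟩
  have hBpos : 0 < B := (inv_pos.mpr (ht 0)).trans_le (hB' 0)
  exact ⟨B⁻¹, M, inv_pos.mpr hBpos,
    fun k => ⟨inv_le_of_inv_le₀ (ht k) (hB' k), hM ⟨k, rfl⟩⟩⟩

theorem tendsto_zero_of_weighted_sq {E ι : Type*} [NormedAddCommGroup E] {l : Filter ι}
    {a : ι → E} {r : ι → ℝ} {m : ℝ} (hm : 0 < m) (hr : Tendsto r l (𝓝 0))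
    (h : ∀ i, m * ‖a i‖ ^ 2 ≤ r i) : Tendsto a l (𝓝 0) := by
  have h1 : Tendsto (fun i => ‖a i‖ ^ 2) l (𝓝 0) := by
    refine squeeze_zero (fun i => sq_nonneg _) (fun i => ?_) (by simpa using hr.div_const m)
    rw [le_div_iff₀ hm, mul_comm]
    exact h i
  rw [tendsto_zero_iff_norm_tendsto_zero]
  simpa using h1.sqrt

theorem tendsto_inner_zero {E ι : Type*} [NormedAddCommGroup E] [InnerProductSpace ℝ E]
    {l : Filter ι} {a b : ι → E} {B : ℝ} (ha : Tendsto a l (𝓝 0)) (hb : ∀ i, ‖b i‖ ≤ B) :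
    Tendsto (fun i => inner ℝ (a i) (b i)) l (𝓝 0) := by
  have h1 : Tendsto (fun i => ‖a i‖ * B) l (𝓝 0) := by simpa using ha.norm.mul_const B
  refine squeeze_zero_norm (fun i => (abs_real_inner_le_norm _ _).trans ?_) h1
  gcongr
  exact hb i

theorem InnerTendsto.of_sub {E ι : Type*} [NormedAddCommGroup E] [InnerProductSpace ℝ E]
    {l : Filter ι} {x u : ι → E} {a : E} (hx : InnerTendsto x l a)
    (h : Tendsto (fun i => u i - x i) l (𝓝 0)) : InnerTendsto u l a := by
  intro w
  have h1 := (hx w).add (tendsto_inner_zero h (b := fun _ => w) fun _ => le_rfl)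
  simpa [← inner_add_left] using h1

theorem innerTendsto_of_ultrafilter {E ι : Type*} [NormedAddCommGroup E]
    [InnerProductSpace ℝ E] {l : Filter ι} {x : ι → E} {a : E}
    (h : ∀ U : Ultrafilter ι, ↑U ≤ l → InnerTendsto x U a) : InnerTendsto x l a :=
  fun w => (tendsto_iff_ultrafilter _ _ _).mpr fun U hU => h U hU w

theorem norm_inv_smul_sub_le {E : Type*} [NormedAddCommGroup E] [InnerProductSpace ℝ E]
    {m τ B : ℝ} (hm : 0 < m) (hτ : m ≤ τ) {p x : E} (hp : ‖p‖ ≤ B) (hx : ‖x‖ ≤ B) :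
    ‖τ⁻¹ • (p - x)‖ ≤ m⁻¹ * (B + B) := by
  rw [norm_smul, norm_inv, Real.norm_of_nonneg (hm.le.trans hτ)]
  gcongr
  exact (norm_sub_le _ _).trans (add_le_add hp hx)

/-- Along bounded points with bounded subgradients the function values have limits. -/
theorem exists_tendsto_values {E ι : Type*} [NormedAddCommGroup E] [InnerProductSpace ℝ E]
    (U : Ultrafilter ι) {h : E → EReal} {x₀ v₀ : E} {φ₀ : ℝ} (hφ₀ : h x₀ = φ₀)
    (hv₀ : IsRealSubgradient h x₀ φ₀ v₀) {x v : ι → E} {φ : ι → ℝ} (hφ : ∀ i, h (x i) = φ i)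
    (hv : ∀ i, IsRealSubgradient h (x i) (φ i) (v i)) {B C : ℝ} (hB : ∀ i, ‖x i‖ ≤ B)
    (hC : ∀ i, ‖v i‖ ≤ C) : ∃ c, Tendsto φ U (𝓝 c) := by
  refine exists_tendsto_of_bounded U (B := |φ₀| + (C + ‖v₀‖) * (‖x₀‖ + B)) fun i => ?_
  have hC0 : 0 ≤ C := (norm_nonneg _).trans (hC i)
  have hB0 : 0 ≤ B := (norm_nonneg _).trans (hB i)
  -- The subgradient at `x i` bounds `φ i` from above, the one at `x₀` from below.
  have h1 := hv i x₀ φ₀ hφ₀.le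
  have h2 := hv₀ (x i) (φ i) (hφ i).le
  have b1 : |inner ℝ (v i) (x₀ - x i)| ≤ C * (‖x₀‖ + B) :=
    (abs_real_inner_le_norm _ _).trans (mul_le_mul (hC i)
      ((norm_sub_le _ _).trans (add_le_add_right (hB i) _)) (norm_nonneg _) hC0)
  have b2 : |inner ℝ v₀ (x i - x₀)| ≤ ‖v₀‖ * (‖x₀‖ + B) := by
    refine (abs_real_inner_le_norm _ _).trans ?_
    rw [norm_sub_rev]
    gcongr
    exact (norm_sub_le _ _).trans (add_le_add_right (hB i) _)
  rw [abs_le] at b1 b2 ⊢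
  have c1 : 0 ≤ C * (‖x₀‖ + B) := by positivity
  have c2 : 0 ≤ ‖v₀‖ * (‖x₀‖ + B) := by positivity
  constructor
  · linarith [neg_abs_le φ₀]
  · linarith [le_abs_self φ₀]

theorem eq_of_weighted_sq_add_eq_zero {E F : Type*} [NormedAddCommGroup E]
    [NormedAddCommGroup F] {r r' : ℝ} (hr : 0 < r) (hr' : 0 < r') {a a' : E} {b b' : F}
    (h : r * ‖a - a'‖ ^ 2 + r' * ‖b - b'‖ ^ 2 = 0) : a = a' ∧ b = b' := by
  obtain ⟨h1, h2⟩ := (add_eq_zero_iff_of_nonneg (by positivity) (by positivity)).mp h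
  constructor
  · simpa [hr.ne', sub_eq_zero] using h1
  · simpa [hr'.ne', sub_eq_zero] using h2

variable {X Y : Type*}
  [NormedAddCommGroup X] [InnerProductSpace ℝ X] [CompleteSpace X]
  [NormedAddCommGroup Y] [InnerProductSpace ℝ Y] [CompleteSpace Y]
  {f : X → EReal} {g : Y → EReal} {K : X →L[ℝ] Y} {t s : ℕ → ℝ} {t_lim s_lim : ℝ}
  {x : ℕ → X} {y : ℕ → Y} {u : ℕ → X} {v : ℕ → Y} {p : ℕ → X} {q : ℕ → Y}

/-- The squared distance, in the metric given by the stepsizes, of the governing sequence to the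
fixed point that belongs to the saddle point `(z, w)`. -/
noncomputable def lyapunov (K : X →L[ℝ] Y) (t s : ℕ → ℝ) (p : ℕ → X) (q : ℕ → Y) (z : X) (w : Y)
    (k : ℕ) : ℝ :=
  s k * ‖p k - (z - t k • ContinuousLinearMap.adjoint K w)‖ ^ 2
    + t k * ‖q k - (w + s k • K z)‖ ^ 2

theorem IsPrimalDualDR.lyapunov_tendsto (hiter : IsPrimalDualDR f g K t s x y u v p q)
    (hf : ProperConvexLSC f) (hg : ProperConvexLSC g)
    (ht_pos : ∀ k, 0 < t k) (hs_pos : ∀ k, 0 < s k)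
    {m M : ℝ} (hm : 0 < m) (ht : ∀ k, m ≤ t k ∧ t k ≤ M) (hs : ∀ k, m ≤ s k ∧ s k ≤ M)
    (ht_sum : Summable fun k => |t (k + 1) - t k|)
    (hs_sum : Summable fun k => |s (k + 1) - s k|)
    {z : X} {w : Y} (h : IsSaddle f g K z w) :
    (∃ c, Tendsto (lyapunov K t s p q z w) atTop (𝓝 c)) ∧
      Tendsto (fun k => s k * ‖u k - x k‖ ^ 2 + t k * ‖v k - y k‖ ^ 2) atTop (𝓝 0) := by
  set A := ContinuousLinearMap.adjoint K with hA
  set D : ℕ → ℝ := fun k => |t (k + 1) - t k| + |s (k + 1) - s k| with hD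
  have hDsum : Summable D := ht_sum.add hs_sum
  have hD0 : ∀ k, 0 ≤ D k := fun k => by positivity
  have hDM : ∀ k, D k ≤ 2 * M := fun k => by
    have h1 : |t (k + 1) - t k| ≤ M :=
      abs_sub_le_of_nonneg_of_le (ht_pos _).le (ht _).2 (ht_pos _).le (ht _).2
    have h2 : |s (k + 1) - s k| ≤ M :=
      abs_sub_le_of_nonneg_of_le (hs_pos _).le (hs _).2 (hs_pos _).le (hs _).2
    simp only [hD]; linarith
  have hM : 0 < M := (ht_pos 0).trans_le (ht 0).2
  -- One constant must bound both the weights (by `M`) and `D k` (by `2 * M`).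
  set N := 2 * M with hN
  have hNM : M ≤ N := by linarith
  have hN0 : 0 < N := by linarith
  set a := (1 + N) / m with ha
  set b := N * (1 + N) * ‖A w‖ ^ 2 + N * (1 + N) * ‖K z‖ ^ 2 with hb
  have ha0 : 0 ≤ a := by positivity
  have hb0 : 0 ≤ b := by positivity
  have hΦ0 : ∀ k, 0 ≤ lyapunov K t s p q z w k := fun k => by
    have := ht_pos k; have := hs_pos k
    unfold lyapunov; positivity
  refine tendsto_of_perturbed_descent (α := fun k => (a + b) * D k) hΦ0
    (fun k => by have := ht_pos k; have := hs_pos k; positivity)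
    (fun k => by have := hD0 k; positivity) (hDsum.mul_left _) fun k => ?_
  have hstep := (norm_sub_add_le_of_step hf hg h (ht_pos k) (hs_pos k) (hiter.prox_primal k)
    (hiter.prox_dual k) (hiter.linear_primal k) (hiter.linear_dual k)).1
  rw [← hiter.update_primal, ← hiter.update_dual] at hstep
  have hp := weight_mul_norm_add_sq_le hm (hs k).1 (hs_pos (k + 1)).le ((hs (k + 1)).2.trans hNM)
    (le_add_of_nonneg_left (abs_nonneg _) : |s (k + 1) - s k| ≤ D k)
    (le_add_of_nonneg_right (abs_nonneg _) : |t (k + 1) - t k| ≤ D k) (hDM k)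
    (p (k + 1) - (z - t k • A w)) (A w)
  have hq := weight_mul_norm_add_sq_le hm (ht k).1 (ht_pos (k + 1)).le ((ht (k + 1)).2.trans hNM)
    (le_add_of_nonneg_right (abs_nonneg _) : |t (k + 1) - t k| ≤ D k)
    (by rw [abs_sub_comm]; exact le_add_of_nonneg_left (abs_nonneg _) :
      |s k - s (k + 1)| ≤ D k) (hDM k)
    (q (k + 1) - (w + s k • K z)) (K z)
  have ep : p (k + 1) - (z - t k • A w) + (t (k + 1) - t k) • A w
      = p (k + 1) - (z - t (k + 1) • A w) := by module
  have eq : q (k + 1) - (w + s k • K z) + (s k - s (k + 1)) • K z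
      = q (k + 1) - (w + s (k + 1) • K z) := by module
  rw [ep] at hp
  rw [eq] at hq
  have hΦ := hΦ0 k
  simp only [lyapunov, ← hA] at hΦ ⊢
  set Φ := s k * ‖p k - (z - t k • A w)‖ ^ 2 + t k * ‖q k - (w + s k • K z)‖ ^ 2
  set r := s k * ‖u k - x k‖ ^ 2 + t k * ‖v k - y k‖ ^ 2 with hr
  have hr0 : 0 ≤ r := by have := ht_pos k; have := hs_pos k; positivity
  have haD : 0 ≤ a * D k := mul_nonneg ha0 (hD0 k)
  -- The descent inequality is scaled by the relative error of the metric change; `h2` and `h3`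
  -- discard the surplus.
  have h1 := mul_le_mul_of_nonneg_left hstep (by linarith : 0 ≤ 1 + a * D k)
  have h2 := mul_nonneg haD hr0
  have h3 := mul_nonneg (mul_nonneg hb0 (hD0 k)) hΦ
  simp only [hb] at h3 ⊢
  linarith

theorem IsPrimalDualDR.bounded (hiter : IsPrimalDualDR f g K t s x y u v p q)
    (hf : ProperConvexLSC f) (hg : ProperConvexLSC g)
    (ht_pos : ∀ k, 0 < t k) (hs_pos : ∀ k, 0 < s k)
    {m M : ℝ} (hm : 0 < m) (ht : ∀ k, m ≤ t k ∧ t k ≤ M) (hs : ∀ k, m ≤ s k ∧ s k ≤ M)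
    {z : X} {w : Y} (h : IsSaddle f g K z w) {c : ℝ}
    (hc : Tendsto (lyapunov K t s p q z w) atTop (𝓝 c)) :
    ∃ B, ∀ k, ‖x k‖ ≤ B ∧ ‖y k‖ ≤ B ∧ ‖p k‖ ≤ B ∧ ‖q k‖ ≤ B := by
  obtain ⟨C, hC⟩ := hc.bddAbove_range
  have hC : ∀ k, lyapunov K t s p q z w k ≤ C := fun k => hC ⟨k, rfl⟩
  set A := ContinuousLinearMap.adjoint K with hA
  set R := √(C / m)
  have hM : 0 < M := (ht_pos 0).trans_le (ht 0).2
  have of_weighted : ∀ {r a b : ℝ}, m ≤ r → 0 ≤ b → r * a ^ 2 + b ≤ C → a ≤ R := by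
    intro r a b hr hb hle
    refine Real.le_sqrt_of_sq_le ((le_div_iff₀ hm).mpr ?_)
    nlinarith [mul_le_mul_of_nonneg_right hr (sq_nonneg a)]
  have hp : ∀ k, ‖p k - (z - t k • A w)‖ ≤ R := fun k =>
    of_weighted (hs k).1 (by have := ht_pos k; positivity) (hC k)
  have hq : ∀ k, ‖q k - (w + s k • K z)‖ ≤ R := fun k =>
    of_weighted (ht k).1 (by have := hs_pos k; positivity) ((add_comm _ _).trans_le (hC k))
  refine ⟨R + ‖z‖ + ‖w‖ + M * ‖A w‖ + M * ‖K z‖, fun k => ?_⟩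
  have hstep := (norm_sub_add_le_of_step hf hg h (ht_pos k) (hs_pos k) (hiter.prox_primal k)
    (hiter.prox_dual k) (hiter.linear_primal k) (hiter.linear_dual k)).2
  have hx := hstep.1.trans (hp k)
  have hy := hstep.2.trans (hq k)
  have n1 : ‖x k‖ ≤ ‖x k - z‖ + ‖z‖ := norm_le_norm_sub_add _ _
  have n2 : ‖y k‖ ≤ ‖y k - w‖ + ‖w‖ := norm_le_norm_sub_add _ _
  have n3 : ‖p k‖ ≤ ‖p k - (z - t k • A w)‖ + ‖z - t k • A w‖ := norm_le_norm_sub_add _ _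
  have n4 : ‖q k‖ ≤ ‖q k - (w + s k • K z)‖ + ‖w + s k • K z‖ := norm_le_norm_sub_add _ _
  have n5 : ‖z - t k • A w‖ ≤ ‖z‖ + M * ‖A w‖ := by
    refine (norm_sub_le _ _).trans ?_
    rw [norm_smul, Real.norm_of_nonneg (ht_pos k).le]
    gcongr
    exact (ht k).2
  have n6 : ‖w + s k • K z‖ ≤ ‖w‖ + M * ‖K z‖ := by
    refine (norm_add_le _ _).trans ?_
    rw [norm_smul, Real.norm_of_nonneg (hs_pos k).le]
    gcongr
    exact (hs k).2
  have := norm_nonneg z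
  have := norm_nonneg w
  have : 0 ≤ M * ‖A w‖ := by positivity
  have : 0 ≤ M * ‖K z‖ := by positivity
  have hpk := hp k
  have hqk := hq k
  refine ⟨?_, ?_, ?_, ?_⟩ <;> linarith

/-- Every weak cluster point of the iteration is a saddle point. -/
theorem IsPrimalDualDR.exists_saddle_limit (hiter : IsPrimalDualDR f g K t s x y u v p q)
    (hf : ProperConvexLSC f) (hg : ProperConvexLSC g)
    (ht_pos : ∀ k, 0 < t k) (hs_pos : ∀ k, 0 < s k)
    {m : ℝ} (hm : 0 < m) (ht : ∀ k, m ≤ t k) (hs : ∀ k, m ≤ s k)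
    (ht_lim_pos : 0 < t_lim) (hs_lim_pos : 0 < s_lim)
    (ht_lim : Tendsto t atTop (𝓝 t_lim)) (hs_lim : Tendsto s atTop (𝓝 s_lim))
    {z : X} {w : Y} (h : IsSaddle f g K z w)
    (hux : Tendsto (fun k => u k - x k) atTop (𝓝 0))
    (hvy : Tendsto (fun k => v k - y k) atTop (𝓝 0))
    {B : ℝ} (hB : ∀ k, ‖x k‖ ≤ B ∧ ‖y k‖ ≤ B ∧ ‖p k‖ ≤ B ∧ ‖q k‖ ≤ B)
    (U : Ultrafilter ℕ) (hU : ↑U ≤ (atTop : Filter ℕ)) :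
    ∃ (a : X) (b : Y), IsSaddle f g K a b ∧ InnerTendsto x U a ∧ InnerTendsto y U b ∧
      InnerTendsto u U a ∧ InnerTendsto v U b ∧
      InnerTendsto p U (a - t_lim • ContinuousLinearMap.adjoint K b) ∧
      InnerTendsto q U (b + s_lim • K a) := by
  set A := ContinuousLinearMap.adjoint K with hA
  have hAK : ∀ y x, inner ℝ (A y) x = inner ℝ y (K x) := fun y x => by
    rw [hA, ContinuousLinearMap.adjoint_inner_left]
  have hKA : ∀ x y, inner ℝ (K x) y = inner ℝ x (A y) := fun x y => by
    rw [hA, ContinuousLinearMap.adjoint_inner_right]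
  obtain ⟨a, ha⟩ := exists_weak_limit U fun k => (hB k).1
  obtain ⟨b, hb⟩ := exists_weak_limit U fun k => (hB k).2.1
  have hux' := hux.mono_left hU
  have hvy' := hvy.mono_left hU
  have hua := ha.of_sub hux'
  have hvb := hb.of_sub hvy'
  have ht' := ht_lim.mono_left hU
  have hs' := hs_lim.mono_left hU
  -- Solving the linear system for `p` and `q` expresses their weak limits through those of the
  -- other sequences.
  have hp : ∀ k, p k = (2 : ℝ) • x k - u k - t k • A (v k) := fun k => by
    rw [sub_sub, hiter.linear_primal k]; abel
  have hq : ∀ k, q k = (2 : ℝ) • y k - v k + s k • K (u k) := fun k => by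
    have := hiter.linear_dual k
    rw [neg_add_eq_iff_eq_add] at this
    rw [sub_add, this]; abel
  have hpa : InnerTendsto p U (a - t_lim • A b) := by
    intro e
    have h1 := (((ha e).const_mul 2).sub (hua e)).sub (ht'.mul (hvb (K e)))
    convert h1 using 2
    · rw [hp, inner_sub_left, inner_sub_left, real_inner_smul_left, real_inner_smul_left, hAK]
    · rw [inner_sub_left, real_inner_smul_left, hAK]; ring
  have hqb : InnerTendsto q U (b + s_lim • K a) := by
    intro e
    have h1 := (((hb e).const_mul 2).sub (hvb e)).add (hs'.mul (hua (A e)))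
    convert h1 using 2
    · rw [hq, inner_add_left, inner_sub_left, real_inner_smul_left, real_inner_smul_left, hKA]
    · rw [inner_add_left, real_inner_smul_left, hKA]; ring
  refine ⟨a, b, ?_, ha, hb, hua, hvb, hpa, hqb⟩
  have hne := h.conjugate_proper
  obtain ⟨φ₀, γ₀, hφ₀, hγ₀, hsub, hsub'⟩ := h
  choose φ hφ hφsub using fun k => (hiter.prox_primal k).exists_isRealSubgradient hf.ne_bot
    hf.exists_ne_top hf.convex_realEpigraph (ht_pos k)
  choose γ hγ hγsub using fun k => (hiter.prox_dual k).exists_isRealSubgradient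
    hg.conjugate_ne_bot hne (convex_realEpigraph_conjugate g) (hs_pos k)
  obtain ⟨φ', hφ'⟩ := exists_tendsto_values U hφ₀ hsub hφ hφsub (fun k => (hB k).1)
    fun k => norm_inv_smul_sub_le hm (ht k) (hB k).2.2.1 (hB k).1
  obtain ⟨γ', hγ'⟩ := exists_tendsto_values U hγ₀ hsub' hγ hγsub (fun k => (hB k).2.1)
    fun k => norm_inv_smul_sub_le hm (hs k) (hB k).2.2.2 (hB k).2.1
  have hfa : f a ≤ φ' := hf.le_of_weak_tendsto ha hφ' fun k => (hφ k).le
  have hgb : conjugate g b ≤ γ' := conjugate_le_of_weak_tendsto g hb hγ' fun k => (hγ k).le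
  obtain ⟨φ₁, hφ₁⟩ := exists_real_eq (hf.ne_bot a) (ne_top_of_le_ne_top (EReal.coe_ne_top _) hfa)
  obtain ⟨γ₁, hγ₁⟩ := exists_real_eq (hg.conjugate_ne_bot b)
    (ne_top_of_le_ne_top (EReal.coe_ne_top _) hgb)
  have hφle : φ₁ ≤ φ' := by rw [hφ₁] at hfa; exact_mod_cast hfa
  have hγle : γ₁ ≤ γ' := by rw [hγ₁] at hgb; exact_mod_cast hgb
  have htinv := ht'.inv₀ ht_lim_pos.ne'
  have hsinv := hs'.inv₀ hs_lim_pos.ne'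
  -- Limit of the sum of both subgradient inequalities. Its bilinear part `⟨v, K x⟩ - ⟨u, A y⟩`
  -- reduces by `g3` to products of a null sequence with a bounded one.
  have key : ∀ (x' : X) (r : ℝ) (y' : Y) (r' : ℝ), f x' ≤ r → conjugate g y' ≤ r' →
      φ' + γ' - inner ℝ (A b) x' + inner ℝ (K a) y' ≤ r + r' := by
    intro x' r y' r' hr hr'
    have e1 := htinv.mul (tendsto_inner_zero hux' (b := fun k => x' - x k)
      fun k => (norm_sub_le _ _).trans (add_le_add_right (hB k).1 _))
    have e2 := hsinv.mul (tendsto_inner_zero hvy' (b := fun k => y' - y k)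
      fun k => (norm_sub_le _ _).trans (add_le_add_right (hB k).2.1 _))
    have e3 := tendsto_inner_zero hvy' (b := fun k => K (x k))
      fun k => (K.le_opNorm _).trans (mul_le_mul_of_nonneg_left (hB k).1 (norm_nonneg _))
    have e4 := tendsto_inner_zero hux' (b := fun k => A (y k))
      fun k => (A.le_opNorm _).trans (mul_le_mul_of_nonneg_left (hB k).2.1 (norm_nonneg _))
    have hlim := ((((((hφ'.add hγ').sub (hvb (K x'))).add (hua (A y'))).sub e1).sub e2).add
      e3).sub e4
    have hle := le_of_tendsto hlim (b := r + r') (Eventually.of_forall fun k => by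
      have s1 := hφsub k x' r hr
      have s2 := hγsub k y' r' hr'
      have g1 : (t k)⁻¹ • (p k - x k) = -((t k)⁻¹ • (u k - x k)) - A (v k) := by
        rw [hp, eq_sub_iff_add_eq, ← inv_smul_smul₀ (ht_pos k).ne' (A (v k)), ← smul_add,
          ← smul_neg, smul_inv_smul₀ (ht_pos k).ne']
        congr 1
        module
      have g2 : (s k)⁻¹ • (q k - y k) = -((s k)⁻¹ • (v k - y k)) + K (u k) := by
        rw [hq, ← inv_smul_smul₀ (hs_pos k).ne' (K (u k)), ← smul_neg, ← smul_add,
          smul_inv_smul₀ (hs_pos k).ne']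
        congr 1
        module
      rw [g1, inner_sub_left, inner_neg_left, real_inner_smul_left, inner_sub_right (A (v k)),
        hAK, hAK] at s1
      rw [g2, inner_add_left, inner_neg_left, real_inner_smul_left, inner_sub_right (K (u k)),
        hKA, hKA] at s2
      have g3 : inner ℝ (u k - x k) (A (y k)) - inner ℝ (v k - y k) (K (x k))
          = inner ℝ (u k) (A (y k)) - inner ℝ (v k) (K (x k)) := by
        rw [inner_sub_left, inner_sub_left, ← hKA (x k), real_inner_comm (K (x k)) (y k)]
        ring
      linarith)
    rw [hAK, hKA]
    linarith
  -- Freezing one variable at its limit separates the joint inequality, using `φ₁ ≤ φ'` and `γ₁ ≤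
  -- γ'`.
  refine ⟨φ₁, γ₁, hφ₁, hγ₁, fun x' r hr => ?_, fun y' r hr => ?_⟩
  · have := key x' r b γ₁ hr hγ₁.le
    rw [← hA, inner_neg_left, inner_sub_right, hAK b a, real_inner_comm (K a) b]
    linarith
  · have := key a φ₁ y' r hφ₁.le hr
    rw [hAK, real_inner_comm] at this
    rw [inner_sub_right]
    linarith

/-- The fixed point that belongs to a saddle point determines the saddle point. -/
theorem saddle_eq_of_fixed_point_eq (K : X →L[ℝ] Y) {t s : ℝ} (ht : 0 < t) (hs : 0 < s)
    {a a' : X} {b b' : Y}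
    (h1 : a - t • ContinuousLinearMap.adjoint K b = a' - t • ContinuousLinearMap.adjoint K b')
    (h2 : b + s • K a = b' + s • K a') : a = a' ∧ b = b' := by
  have e1 : a - a' = t • ContinuousLinearMap.adjoint K (b - b') := by
    rw [map_sub, smul_sub, sub_eq_sub_iff_add_eq_add]
    rw [sub_eq_sub_iff_add_eq_add] at h1
    rw [h1, add_comm]
  have e2 : b - b' = -(s • K (a - a')) := by
    rw [map_sub, smul_sub, neg_sub, sub_eq_sub_iff_add_eq_add, h2, add_comm]
  have e3 : ‖a - a'‖ ^ 2 = t * inner ℝ (b - b') (K (a - a')) := by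
    rw [← real_inner_self_eq_norm_sq]
    nth_rewrite 1 [e1]
    rw [real_inner_smul_left, ContinuousLinearMap.adjoint_inner_left]
  have e4 : ‖b - b'‖ ^ 2 = -(s * inner ℝ (b - b') (K (a - a'))) := by
    rw [← real_inner_self_eq_norm_sq]
    nth_rewrite 2 [e2]
    rw [inner_neg_right, real_inner_smul_right]
  have e5 : s * ‖a - a'‖ ^ 2 + t * ‖b - b'‖ ^ 2 = 0 := by rw [e3, e4]; ring
  exact eq_of_weighted_sq_add_eq_zero hs ht e5

/-- Opial's argument: two weak cluster points at which the Lyapunov functionals converge agree. -/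
theorem saddle_limit_unique {K : X →L[ℝ] Y} {t s : ℕ → ℝ} {p : ℕ → X} {q : ℕ → Y}
    (ht_lim_pos : 0 < t_lim) (hs_lim_pos : 0 < s_lim)
    (ht_lim : Tendsto t atTop (𝓝 t_lim)) (hs_lim : Tendsto s atTop (𝓝 s_lim))
    {a a' : X} {b b' : Y} {c c' : ℝ}
    (hc : Tendsto (lyapunov K t s p q a b) atTop (𝓝 c))
    (hc' : Tendsto (lyapunov K t s p q a' b') atTop (𝓝 c'))
    {U U' : Ultrafilter ℕ} (hU : ↑U ≤ (atTop : Filter ℕ)) (hU' : ↑U' ≤ (atTop : Filter ℕ))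
    (hp : InnerTendsto p U (a - t_lim • ContinuousLinearMap.adjoint K b))
    (hq : InnerTendsto q U (b + s_lim • K a))
    (hp' : InnerTendsto p U' (a' - t_lim • ContinuousLinearMap.adjoint K b'))
    (hq' : InnerTendsto q U' (b' + s_lim • K a')) : a = a' ∧ b = b' := by
  set A := ContinuousLinearMap.adjoint K with hA
  set P := a - t_lim • A b with hP
  set P' := a' - t_lim • A b' with hP'
  set Q := b + s_lim • K a with hQ
  set Q' := b' + s_lim • K a' with hQ'
  -- The squares of `p k` and `q k` cancel, leaving an expression affine in them. Pulling out `t k`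
  -- and `s k` leaves fixed test vectors, so weak limits apply.
  have hdiff : ∀ k, lyapunov K t s p q a b k - lyapunov K t s p q a' b' k =
      s k * (‖a - t k • A b‖ ^ 2 - ‖a' - t k • A b'‖ ^ 2
          - 2 * (inner ℝ (p k) (a - a') - t k * inner ℝ (p k) (A b - A b')))
        + t k * (‖b + s k • K a‖ ^ 2 - ‖b' + s k • K a'‖ ^ 2
          - 2 * (inner ℝ (q k) (b - b') + s k * inner ℝ (q k) (K a - K a'))) := by
    intro k
    simp only [lyapunov, ← hA]
    rw [norm_sub_sq_real (p k), norm_sub_sq_real (p k), norm_sub_sq_real (q k),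
      norm_sub_sq_real (q k)]
    simp only [inner_sub_right, inner_add_right, real_inner_smul_right]
    ring
  -- The limit `c - c'` is the same along `U` and `U'`; equating the two formulas gives `h3`.
  have hlim : ∀ {V : Ultrafilter ℕ} {P₀ : X} {Q₀ : Y}, ↑V ≤ (atTop : Filter ℕ) →
      InnerTendsto p V P₀ → InnerTendsto q V Q₀ →
      c - c' = s_lim * (‖P‖ ^ 2 - ‖P'‖ ^ 2 - 2 * inner ℝ P₀ (P - P'))
        + t_lim * (‖Q‖ ^ 2 - ‖Q'‖ ^ 2 - 2 * inner ℝ Q₀ (Q - Q')) := by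
    intro V P₀ Q₀ hV hp hq
    have ht := ht_lim.mono_left hV
    have hs := hs_lim.mono_left hV
    have h1 := (hc.sub hc').mono_left hV
    simp only [hdiff] at h1
    have n1 := ((tendsto_const_nhds (x := a)).sub (ht.smul_const (A b))).norm.pow 2
    have n2 := ((tendsto_const_nhds (x := a')).sub (ht.smul_const (A b'))).norm.pow 2
    have n3 := ((tendsto_const_nhds (x := b)).add (hs.smul_const (K a))).norm.pow 2
    have n4 := ((tendsto_const_nhds (x := b')).add (hs.smul_const (K a'))).norm.pow 2
    have h2 := (hs.mul ((n1.sub n2).sub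
        (((hp (a - a')).sub (ht.mul (hp (A b - A b')))).const_mul 2))).add
      (ht.mul ((n3.sub n4).sub
        (((hq (b - b')).add (hs.mul (hq (K a - K a')))).const_mul 2)))
    rw [tendsto_nhds_unique h1 h2]
    have i1 : P - P' = (a - a') - t_lim • (A b - A b') := by rw [hP, hP']; module
    have i2 : Q - Q' = (b - b') + s_lim • (K a - K a') := by rw [hQ, hQ']; module
    rw [i1, i2, inner_sub_right (𝕜 := ℝ) P₀ (a - a'), inner_add_right, real_inner_smul_right,
      real_inner_smul_right]
  have h1 := hlim hU hp hq
  have h2 := hlim hU' hp' hq'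
  have h3 : s_lim * ‖P - P'‖ ^ 2 + t_lim * ‖Q - Q'‖ ^ 2 = 0 := by
    rw [← real_inner_self_eq_norm_sq, ← real_inner_self_eq_norm_sq, inner_sub_left,
      inner_sub_left Q]
    linarith
  obtain ⟨hPP, hQQ⟩ := eq_of_weighted_sq_add_eq_zero hs_lim_pos ht_lim_pos h3
  exact saddle_eq_of_fixed_point_eq K ht_lim_pos hs_lim_pos hPP hQQ

end Iteration

end PDDR

theorem proposition3p6 {X Y : Type*}
    [NormedAddCommGroup X] [InnerProductSpace ℝ X] [CompleteSpace X]
    [NormedAddCommGroup Y] [InnerProductSpace ℝ Y] [CompleteSpace Y]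
    (f : X → EReal) (g : Y → EReal) (K : X →L[ℝ] Y)
    (hf : PDDR.ProperConvexLSC f) (hg : PDDR.ProperConvexLSC g)
    (t s : ℕ → ℝ) (t_lim s_lim : ℝ)
    (ht_pos : ∀ k, 0 < t k) (hs_pos : ∀ k, 0 < s k)
    (ht_lim_pos : 0 < t_lim) (hs_lim_pos : 0 < s_lim)
    (ht_lim : Tendsto t atTop (𝓝 t_lim)) (hs_lim : Tendsto s atTop (𝓝 s_lim))
    (ht_sum : Summable fun k => |t (k + 1) - t k|)
    (hs_sum : Summable fun k => |s (k + 1) - s k|)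
    -- a finite minimizer of the primal problem exists
    (hmin : ∃ z : X, PDDR.IsFiniteMinimizer (PDDR.primalObjective f g K) z)
    -- the problem is regular: its minimizers satisfy the primal-dual optimality condition
    -- `0 ∈ ∂f(z) + K* ∂g(K z)`
    (hreg : ∀ z : X, PDDR.IsFiniteMinimizer (PDDR.primalObjective f g K) z →
      (0 : X) ∈ PDDR.subdifferential f z +
        ContinuousLinearMap.adjoint K '' PDDR.subdifferential g (K z))
    (x : ℕ → X) (y : ℕ → Y) (u : ℕ → X) (v : ℕ → Y) (p : ℕ → X) (q : ℕ → Y)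
    (hiter : PDDR.IsPrimalDualDR f g K t s x y u v p q) :
    ∃ (x_lim : X) (y_lim : Y) (u_lim : X) (v_lim : Y) (p_lim : X) (q_lim : Y),
      PDDR.WeaklyTendsto x x_lim ∧ PDDR.WeaklyTendsto y y_lim ∧
      PDDR.WeaklyTendsto u u_lim ∧ PDDR.WeaklyTendsto v v_lim ∧
      PDDR.WeaklyTendsto p p_lim ∧ PDDR.WeaklyTendsto q q_lim ∧
      PDDR.IsFiniteMinimizer (PDDR.primalObjective f g K) x_lim := by

  obtain ⟨z, hz⟩ := hmin
  obtain ⟨w, hw⟩ := PDDR.exists_isSaddle hf hg (hreg z hz)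
  obtain ⟨m₁, M₁, hm₁, ht⟩ := PDDR.exists_pos_bounds ht_pos ht_lim_pos ht_lim
  obtain ⟨m₂, M₂, hm₂, hs⟩ := PDDR.exists_pos_bounds hs_pos hs_lim_pos hs_lim
  have hm : 0 < min m₁ m₂ := lt_min hm₁ hm₂
  have ht' : ∀ k, min m₁ m₂ ≤ t k ∧ t k ≤ max M₁ M₂ := fun k =>
    ⟨(min_le_left _ _).trans (ht k).1, (ht k).2.trans (le_max_left _ _)⟩
  have hs' : ∀ k, min m₁ m₂ ≤ s k ∧ s k ≤ max M₁ M₂ := fun k =>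
    ⟨(min_le_right _ _).trans (hs k).1, (hs k).2.trans (le_max_right _ _)⟩
  have hlyap := fun {a : X} {b : Y} (h : PDDR.IsSaddle f g K a b) =>
    hiter.lyapunov_tendsto hf hg ht_pos hs_pos hm ht' hs' ht_sum hs_sum h
  obtain ⟨⟨c, hc⟩, hr⟩ := hlyap hw
  have hux : Tendsto (fun k => u k - x k) atTop (𝓝 0) :=
    PDDR.tendsto_zero_of_weighted_sq hm hr fun k => by
      have h1 := mul_le_mul_of_nonneg_right (hs' k).1 (sq_nonneg ‖u k - x k‖)
      have h2 := mul_nonneg (ht_pos k).le (sq_nonneg ‖v k - y k‖)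
      linarith
  have hvy : Tendsto (fun k => v k - y k) atTop (𝓝 0) :=
    PDDR.tendsto_zero_of_weighted_sq hm hr fun k => by
      have h1 := mul_le_mul_of_nonneg_right (ht' k).1 (sq_nonneg ‖v k - y k‖)
      have h2 := mul_nonneg (hs_pos k).le (sq_nonneg ‖u k - x k‖)
      linarith
  obtain ⟨B, hB⟩ := hiter.bounded hf hg ht_pos hs_pos hm ht' hs' hw hc
  have hcluster := hiter.exists_saddle_limit hf hg ht_pos hs_pos hm (fun k => (ht' k).1)
    (fun k => (hs' k).1) ht_lim_pos hs_lim_pos ht_lim hs_lim hw hux hvy hB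
  -- One ultrafilter fixes the candidate limit; every other one is then compared with it.
  obtain ⟨a, b, hab, -, -, -, -, hp, hq⟩ := hcluster (hyperfilter ℕ) Nat.hyperfilter_le_atTop
  obtain ⟨⟨c₁, hc₁⟩, -⟩ := hlyap hab
  have hall : ∀ U : Ultrafilter ℕ, ↑U ≤ (atTop : Filter ℕ) →
      PDDR.InnerTendsto x U a ∧ PDDR.InnerTendsto y U b ∧
      PDDR.InnerTendsto u U a ∧ PDDR.InnerTendsto v U b ∧
      PDDR.InnerTendsto p U (a - t_lim • ContinuousLinearMap.adjoint K b) ∧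
      PDDR.InnerTendsto q U (b + s_lim • K a) := by
    intro U hU
    obtain ⟨a', b', hab', hrest⟩ := hcluster U hU
    obtain ⟨⟨c₂, hc₂⟩, -⟩ := hlyap hab'
    obtain ⟨rfl, rfl⟩ := PDDR.saddle_limit_unique ht_lim_pos hs_lim_pos ht_lim hs_lim hc₁ hc₂
      Nat.hyperfilter_le_atTop hU hp hq hrest.2.2.2.2.1 hrest.2.2.2.2.2
    exact hrest
  exact ⟨a, b, a, b, a - t_lim • ContinuousLinearMap.adjoint K b, b + s_lim • K a,
    (PDDR.innerTendsto_of_ultrafilter fun U hU => (hall U hU).1).weaklyTendsto,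
    (PDDR.innerTendsto_of_ultrafilter fun U hU => (hall U hU).2.1).weaklyTendsto,
    (PDDR.innerTendsto_of_ultrafilter fun U hU => (hall U hU).2.2.1).weaklyTendsto,
    (PDDR.innerTendsto_of_ultrafilter fun U hU => (hall U hU).2.2.2.1).weaklyTendsto,
    (PDDR.innerTendsto_of_ultrafilter fun U hU => (hall U hU).2.2.2.2.1).weaklyTendsto,
    (PDDR.innerTendsto_of_ultrafilter fun U hU => (hall U hU).2.2.2.2.2).weaklyTendsto,
    hab.isFiniteMinimizer hf hg⟩
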